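/- Let $\Sigma$ be a finite alphabet. A weighted finite automaton (WFA) of dimension $n$ is a tuple $A=\langle\alpha_0,\alpha_\infty,\{A_\sigma\}_{\sigma\in\Sigma}\rangle$ with $\alpha_0,\alpha_\infty\in\mathbb{R}^n$ and $A_\sigma\in\mathbb{R}^{n\times n}$; it realizes $f_A:\Sigma^\star\to\mathbb{R}$, $f_A(x_1\cdots x_t)=\alpha_0^\top A_{x_1}\cdots A_{x_t}\alpha_\infty$. A function realized by some WFA is called rational; its rank is the least dimension of a WFA realizing it, and a WFA of this dimension is called minimal. For square matrices $L,R$ write $LAR=\langle R^\top\alpha_0, L\alpha_\infty,\{LA_\sigma R\}\rangle$. A reduced SVD of a (possibly infinite) matrix $M$ of rank $n$ is a factorization $M=UDV^\top$ where $U$ and $V$ have $n$ columns, orthonormal in $\ell^2$, and $D=\mathrm{diag}(\mathfrak{s}_1,\dots,\mathfrak{s}_n)$ with $\mathfrak{s}_1\ge\cdots\ge\mathfrak{s}_n>0$. The Hankel singular values of $f$ are the singular values $\mathfrak{s}_1\ge\cdots\ge\mathfrak{s}_n$ in a reduced SVD of the Hankel matrix $H_f\in\mathbb{R}^{\Sigma^\star\times\Sigma^\star}$,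 $H_f(p,q)=f(pq)$. For a minimal WFA $A$ of dimension $n$ put $A^\otimes=\sum_\sigma A_\sigma\otimes A_\sigma$. If the spectral radius satisfies $\rho(A^\otimes)<1$ and $\hat n<n$, the algorithm SVATruncation$(A,\hat n)$ does the following. 1. Compute $G_p,G_s\in\mathbb{R}^{n\times n}$ from $\mathrm{vec}(G_p)^\top=(\alpha_0\otimes\alpha_0)^\top(I-A^\otimes)^{-1}$ and $\mathrm{vec}(G_s)=(I-A^\otimes)^{-1}(\alpha_\infty\otimes\alpha_\infty)$. 2. Take spectral decompositions $G_p=V_pD_pV_p^\top$ and $G_s=V_sD_sV_s^\top$ (with $V_p,V_s$ orthogonal) and a reduced SVD $D_p^{1/2}V_p^\top V_sD_s^{1/2}=\tilde U D\tilde V^\top$ with $D$ of size $n\times n$; put $Q_p=V_pD_p^{-1/2}\tilde U$, $Q_s=V_sD_s^{-1/2}\tilde V$ and $A'=D^{1/2}Q_s^\top\,A\,Q_pD^{1/2}=\langle\alpha_0',\alpha_\infty',\{A'_\sigma\}\rangle$. 3. With $\Pi=[I_{\hat n}\ 0]\in\mathbb{R}^{\hat n\times n}$, return $\hat A=\langle\Pi\alpha_0',\Pi\alpha_\infty',\{\Pi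 A'_\sigma\Pi^\top\}\rangle$. **Theorem.** Let $f:\Sigma^\star\to\mathbb{R}$ be rational of rank $n$ with $\sum_x|f(x)|<\infty$. Then $f$ has Hankel singular values $\mathfrak{s}_1\ge\cdots\ge\mathfrak{s}_n>0$, and there is a constant $C_f>0$, depending only on $f$, such that for every $0<\hat n<n$ and every minimal WFA $A$ realizing $f$ with $\rho(A^\otimes)<1$ the following holds: all steps of SVATruncation$(A,\hat n)$ can be carried out, and, for every choice of the decompositions in step 2, the function $\hat f$ realized by the output $\hat A$ satisfies $$\|f-\hat f\|_2^2=\sum_{x\in\Sigma^\star}(f(x)-\hat f(x))^2\le C_f\sqrt{\mathfrak{s}_{\hat n+1}+\cdots+\mathfrak{s}_n}.$$ -/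

import Mathlib

open scoped Matrix Kronecker

noncomputable section

/-- A weighted finite automaton with real weights and states `Fin n` over the alphabet `α`. -/
structure WFA (α : Type*) (n : ℕ) where
  /-- initial weights -/
  init : Fin n → ℝ
  /-- final weights -/
  final : Fin n → ℝ
  /-- transition weights -/
  trans : α → Matrix (Fin n) (Fin n) ℝ

/-- The transition matrix of a string `x₁ ⋯ x_t`, i.e. the product `A_{x₁} ⋯ A_{x_t}`. -/
def WFA.word {α : Type*} {n : ℕ} (A : WFA α n) (x : List α) : Matrix (Fin n) (Fin n) ℝ :=
  (x.map A.trans).prod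

/-- The function on strings realized by the automaton. -/
def WFA.fn {α : Type*} {n : ℕ} (A : WFA α n) (x : List α) : ℝ :=
  A.init ⬝ᵥ (A.word x *ᵥ A.final)

/-- `f` is rational if some WFA realizes it. -/
def IsRational {α : Type*} (f : List α → ℝ) : Prop :=
  ∃ (m : ℕ) (A : WFA α m), A.fn = f

/-- The rank of a rational function: the least dimension of a WFA realizing it. -/
def seriesRank {α : Type*} (f : List α → ℝ) : ℕ :=
  sInf {m : ℕ | ∃ A : WFA α m, A.fn = f}

/-- A WFA is minimal if its dimension is the rank of the function it realizes. -/
def WFA.IsMinimal {α : Type*} {n : ℕ} (A : WFA α n) : Prop :=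
  n = seriesRank A.fn

/-- The bi-infinite Hankel matrix `H_f(p, q) = f(pq)`. -/
def hankel {α : Type*} (f : List α → ℝ) : Matrix (List α) (List α) ℝ :=
  Matrix.of fun p q => f (p ++ q)

/-- `M = U diag(s) Vᵀ` is a reduced singular value decomposition with inner dimension `n`:
the columns of `U` and of `V` are orthonormal in `ℓ²`, and `s₁ ≥ ⋯ ≥ s_n > 0`.
The index sets `I`, `J` of `M` may be infinite. -/
structure IsReducedSVD {I J : Type*} {n : ℕ} (M : Matrix I J ℝ) (U : Matrix I (Fin n) ℝ)
    (s : Fin n → ℝ) (V : Matrix J (Fin n) ℝ) : Prop where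
  pos : ∀ i, 0 < s i
  antitone : Antitone s
  left_orthonormal : ∀ i j, HasSum (fun x => U x i * U x j) (if i = j then 1 else 0)
  right_orthonormal : ∀ i j, HasSum (fun y => V y i * V y j) (if i = j then 1 else 0)
  eq : ∀ x y, M x y = ∑ i, U x i * s i * V y i

/-- `s₁ ≥ ⋯ ≥ s_n > 0` are the Hankel singular values of `f`. -/
def IsHankelSingularValues {α : Type*} {n : ℕ} (f : List α → ℝ) (s : Fin n → ℝ) : Prop :=
  ∃ U V : Matrix (List α) (Fin n) ℝ, IsReducedSVD (hankel f) U s V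

/-- The matrix `∑_σ A_σ ⊗ A_σ`. -/
def WFA.tensorSq {α : Type*} [Fintype α] {n : ℕ} (A : WFA α n) :
    Matrix (Fin n × Fin n) (Fin n × Fin n) ℝ :=
  ∑ a, A.trans a ⊗ₖ A.trans a

/-- The spectral radius of a real square matrix: the largest modulus of a complex eigenvalue. -/
def matrixSpectralRadius {ι : Type*} [Fintype ι] [DecidableEq ι] (M : Matrix ι ι ℝ) :
    ENNReal :=
  spectralRadius ℂ (M.map Complex.ofReal)

/-- The matrix `G_p` with `vec(G_p)ᵀ = (α₀ ⊗ α₀)ᵀ (I - ∑_σ A_σ ⊗ A_σ)⁻¹`. -/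
def WFA.gramP {α : Type*} [Fintype α] {n : ℕ} (A : WFA α n) : Matrix (Fin n) (Fin n) ℝ :=
  Matrix.of fun i j =>
    ((fun k : Fin n × Fin n => A.init k.1 * A.init k.2) ᵥ* (1 - A.tensorSq)⁻¹) (i, j)

/-- The matrix `G_s` with `vec(G_s) = (I - ∑_σ A_σ ⊗ A_σ)⁻¹ (α_∞ ⊗ α_∞)`. -/
def WFA.gramS {α : Type*} [Fintype α] {n : ℕ} (A : WFA α n) : Matrix (Fin n) (Fin n) ℝ :=
  Matrix.of fun i j =>
    ((1 - A.tensorSq)⁻¹ *ᵥ (fun k : Fin n × Fin n => A.final k.1 * A.final k.2)) (i, j)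

/-- `G = W diag(d) Wᵀ` is a spectral decomposition with `W` orthogonal. -/
def IsSpectralDecomposition {n : ℕ} (G W : Matrix (Fin n) (Fin n) ℝ) (d : Fin n → ℝ) : Prop :=
  W ∈ Matrix.orthogonalGroup (Fin n) ℝ ∧ G = W * Matrix.diagonal d * Wᵀ

/-- The WFA `L A R = ⟨Rᵀ α₀, L α_∞, {L A_σ R}⟩`; it is the conjugate `Q⁻¹ A Q` when `R = Q`
and `L = Q⁻¹`. -/
def WFA.transform {α : Type*} {n m : ℕ} (A : WFA α n) (L : Matrix (Fin m) (Fin n) ℝ)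
    (R : Matrix (Fin n) (Fin m) ℝ) : WFA α m where
  init := Rᵀ *ᵥ A.init
  final := L *ᵥ A.final
  trans a := L * A.trans a * R

/-- `A'` is an output of ComputeSVA on input `A`. The algorithm picks spectral decompositions
`G_p = V_p D_p V_pᵀ`, `G_s = V_s D_s V_sᵀ` and a reduced SVD `Ũ D Ṽᵀ` of
`D_p^{1/2} V_pᵀ V_s D_s^{1/2}`; with `Q_p = V_p D_p^{-1/2} Ũ` and `Q_s = V_s D_s^{-1/2} Ṽ`
it returns `D^{1/2} Q_sᵀ A Q_p D^{1/2}`. Every such choice is allowed. -/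
def ComputeSVA {α : Type*} [Fintype α] {n : ℕ} (A A' : WFA α n) : Prop :=
  ∃ (Vp Vs U V : Matrix (Fin n) (Fin n) ℝ) (dp ds d : Fin n → ℝ),
    IsSpectralDecomposition A.gramP Vp dp ∧
    IsSpectralDecomposition A.gramS Vs ds ∧
    IsReducedSVD
      (Matrix.diagonal (fun i => √(dp i)) * Vpᵀ * Vs * Matrix.diagonal (fun i => √(ds i)))
      U d V ∧
    A' = A.transform
      (Matrix.diagonal (fun i => √(d i)) *
        (Vs * Matrix.diagonal (fun i => (√(ds i))⁻¹) * V)ᵀ)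
      ((Vp * Matrix.diagonal (fun i => (√(dp i))⁻¹) * U) *
        Matrix.diagonal (fun i => √(d i)))

/-- The `m × n` matrix `Π = [I_m 0]`. -/
def truncMatrix (m n : ℕ) : Matrix (Fin m) (Fin n) ℝ :=
  Matrix.of fun i j => if (i : ℕ) = (j : ℕ) then 1 else 0

/-- `B` is an output of SVATruncation on input `A` and `m`: for an output `A'` of ComputeSVA,
`B = ⟨Π α₀', Π α_∞', {Π A'_σ Πᵀ}⟩`. -/
def SVATruncation {α : Type*} [Fintype α] {n : ℕ} (A : WFA α n) (m : ℕ) (B : WFA α m) : Prop :=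
  ∃ A' : WFA α n, ComputeSVA A A' ∧ B = A'.transform (truncMatrix m n) (truncMatrix m n)ᵀ

end

/-! Since `A` is minimal, its forward vectors `α₀ᵀ A_x` are finite linear combinations of shifts of
`f`, so they lie in `ℓ¹`, and likewise the backward vectors `A_x α_∞`. Both families therefore have
Gram matrices, positive definite by minimality. The condition `ρ(A^⊗) < 1` makes the linear
equations for `G_p`, `G_s` uniquely solvable, so the algorithm finds exactly these Gram matrices,
and its change of basis turns both into `diag(s)`. The Hankel matrix then factors as forward times
backward vectors, which after rescaling by `√s` is a reduced SVD.

For such an automaton the truncation error at `x` telescopes over the cuts `x = uv`: each cut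
contributes the pairing, in the discarded coordinates, of the forward vector of `u` with the
backward vector of `v` computed by the truncated dynamics. The Stein equation `D = α_∞ α_∞ᵀ + ∑ A_σ
D A_σᵀ` with `D` diagonal shows that the `i`-th truncated backward coordinate has squared `ℓ²` norm
at most `s i`, because deleting coordinates only decreases the form of `D`. Young's inequality `‖a *
b‖₂ ≤ ‖a‖₁ ‖b‖₂` on words then bounds the squared error by `(∑ ‖pre x‖)²` times the sum of the
discarded `s i` (`IsSVA.truncation_error`).

The constant depends on `f` alone: `‖pre x‖²` is a diagonal entry of `U diag(s) Uᵀ`, which is the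
same for every reduced SVD of the Hankel matrix (`IsReducedSVD.sum_mul_sq_unique`). -/

noncomputable section

open Finset

/-! ### Forward and backward vectors, minimality and summability -/

namespace WFA

variable {α : Type*} {n : ℕ}

/-- The forward vector `α₀ᵀ A_x` of a word. -/
def pre (A : WFA α n) (x : List α) : Fin n → ℝ :=
  A.init ᵥ* A.word x

/-- The backward vector `A_x α_∞` of a word. -/
def suf (A : WFA α n) (x : List α) : Fin n → ℝ :=
  A.word x *ᵥ A.final

@[simp] theorem word_nil (A : WFA α n) : A.word [] = 1 := by simp [word]

@[simp] theorem word_cons (A : WFA α n) (a : α) (x : List α) :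
    A.word (a :: x) = A.trans a * A.word x := by simp [word]

theorem word_append (A : WFA α n) (x y : List α) : A.word (x ++ y) = A.word x * A.word y := by
  simp [word]

@[simp] theorem suf_nil (A : WFA α n) : A.suf [] = A.final := by simp [suf]

@[simp] theorem suf_cons (A : WFA α n) (a : α) (x : List α) :
    A.suf (a :: x) = A.trans a *ᵥ A.suf x := by simp [suf, Matrix.mulVec_mulVec]

theorem fn_append (A : WFA α n) (x y : List α) : A.fn (x ++ y) = A.pre x ⬝ᵥ A.suf y := by
  rw [fn, word_append, pre, suf, ← Matrix.mulVec_mulVec, Matrix.dotProduct_mulVec]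

theorem fn_eq_init_suf (A : WFA α n) (x : List α) : A.fn x = A.init ⬝ᵥ A.suf x := rfl

/-- The automaton reading words backwards. -/
def rev (A : WFA α n) : WFA α n where
  init := A.final
  final := A.init
  trans a := (A.trans a)ᵀ

theorem word_rev (A : WFA α n) (x : List α) : A.rev.word x = (A.word x.reverse)ᵀ := by
  induction x with
  | nil => simp
  | cons a x ih =>
    rw [word_cons, ih, List.reverse_cons, word_append, Matrix.transpose_mul]
    simp [rev]

theorem suf_rev (A : WFA α n) (x : List α) : A.rev.suf x = A.pre x.reverse := by
  rw [suf, word_rev, Matrix.mulVec_transpose]; rfl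

theorem fn_rev (A : WFA α n) (x : List α) : A.rev.fn x = A.fn x.reverse := by
  rw [fn, word_rev, fn, Matrix.mulVec_transpose, dotProduct_comm, Matrix.dotProduct_mulVec]
  rfl

theorem rev_rev (A : WFA α n) : A.rev.rev = A := by simp [rev]

/-- An automaton whose final vector and transitions factor through an `n × r` matrix can be
compressed to dimension `r`. -/
theorem exists_fn_eq_of_factor {r : ℕ} (A : WFA α n) (E : Matrix (Fin n) (Fin r) ℝ)
    (hT : ∀ a, ∃ T : Matrix (Fin r) (Fin r) ℝ, A.trans a * E = E * T)
    (hβ : ∃ β, A.final = E *ᵥ β) : ∃ B : WFA α r, B.fn = A.fn := by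
  choose T hT using hT
  obtain ⟨β, hβ⟩ := hβ
  refine ⟨⟨A.init ᵥ* E, β, T⟩, ?_⟩
  have key : ∀ x, A.suf x = E *ᵥ (WFA.suf ⟨A.init ᵥ* E, β, T⟩ x) := by
    intro x
    induction x with
    | nil => simpa using hβ
    | cons a x ih => simp [ih, Matrix.mulVec_mulVec, hT]
  funext x
  rw [fn_eq_init_suf, fn_eq_init_suf, key, Matrix.dotProduct_mulVec]

theorem seriesRank_le (A : WFA α n) : seriesRank A.fn ≤ n := Nat.sInf_le ⟨A, rfl⟩

/-- The span contains the final vector and is stable under every transition, so the automaton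
restricts to it; minimality forbids a smaller dimension. -/
theorem IsMinimal.span_suf {A : WFA α n} (hA : A.IsMinimal) :
    Submodule.span ℝ (Set.range A.suf) = ⊤ := by
  set W := Submodule.span ℝ (Set.range A.suf) with hW
  let b := Module.finBasis ℝ W
  let E : Matrix (Fin n) (Fin (Module.finrank ℝ W)) ℝ := Matrix.of fun i j => (b j : Fin n → ℝ) i
  have hE : ∀ w ∈ W, ∃ c, w = E *ᵥ c := by
    intro w hw
    refine ⟨b.repr ⟨w, hw⟩, ?_⟩
    have h := congrArg (Subtype.val) (b.sum_repr ⟨w, hw⟩)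
    funext i
    have h' := congrFun h i
    simp only [Submodule.coe_sum, Submodule.coe_smul, Finset.sum_apply, Pi.smul_apply,
      smul_eq_mul] at h'
    rw [← h']
    simp [Matrix.mulVec, dotProduct, E, mul_comm]
  have hinv : ∀ a, ∀ w ∈ W, A.trans a *ᵥ w ∈ W := by
    intro a w hw
    have : W ≤ W.comap (Matrix.mulVecLin (A.trans a)) := by
      rw [hW, Submodule.span_le]
      rintro _ ⟨x, rfl⟩
      exact Submodule.subset_span ⟨a :: x, by simp⟩
    exact this hw
  obtain ⟨B, hB⟩ := A.exists_fn_eq_of_factor E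
    (fun a => by
      choose c hc using fun j => hE _ (hinv a _ (b j).2)
      refine ⟨Matrix.of fun i j => c j i, ?_⟩
      ext i j
      exact congrFun (hc j) i)
    (hE _ (Submodule.subset_span ⟨[], by simp⟩))
  have h1 := B.seriesRank_le
  rw [hB, ← show n = seriesRank A.fn from hA] at h1
  apply Submodule.eq_top_of_finrank_eq
  have h2 := Submodule.finrank_le W
  simp only [Module.finrank_fin_fun] at h2 ⊢
  omega

theorem IsMinimal.rev {A : WFA α n} (hA : A.IsMinimal) : A.rev.IsMinimal := by
  refine le_antisymm ?_ A.rev.seriesRank_le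
  have hne : {m : ℕ | ∃ B : WFA α m, B.fn = A.rev.fn}.Nonempty := ⟨n, A.rev, rfl⟩
  obtain ⟨B, hB⟩ := Nat.sInf_mem hne
  have hBA : B.rev.fn = A.fn := by
    funext x
    rw [fn_rev, hB, fn_rev, List.reverse_reverse]
  have h := B.rev.seriesRank_le
  rw [hBA, ← show n = seriesRank A.fn from hA] at h
  exact h

/-- A vector orthogonal to all backward vectors of a minimal automaton vanishes. -/
theorem IsMinimal.eq_zero_of_suf {A : WFA α n} (hA : A.IsMinimal) {v : Fin n → ℝ}
    (hv : ∀ x, v ⬝ᵥ A.suf x = 0) : v = 0 := by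
  have h : Submodule.span ℝ (Set.range A.suf) ≤ LinearMap.ker (dotProductBilin ℝ ℝ v) := by
    rw [Submodule.span_le]
    rintro _ ⟨x, rfl⟩
    exact hv x
  rw [hA.span_suf] at h
  exact dotProduct_self_eq_zero.1 (h (Submodule.mem_top (x := v)))

/-- The `i`-th basis vector is a finite combination of backward vectors, so the coordinate is a
finite combination of the functions `x ↦ f (x ++ q)`, each absolutely summable. -/
theorem IsMinimal.summable_pre {A : WFA α n} (hA : A.IsMinimal)
    (hf : Summable fun x => |A.fn x|) (i : Fin n) : Summable fun x => |A.pre x i| := by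
  have hi : (Pi.single i 1 : Fin n → ℝ) ∈ Submodule.span ℝ (Set.range A.suf) := by
    rw [hA.span_suf]; trivial
  obtain ⟨c, hc⟩ := Finsupp.mem_span_range_iff_exists_finsupp.1 hi
  have key : ∀ x, A.pre x i = ∑ q ∈ c.support, c q * A.fn (x ++ q) := by
    intro x
    have : A.pre x i = A.pre x ⬝ᵥ Pi.single i 1 := by simp
    rw [this, ← hc, Finsupp.sum, dotProduct_sum]
    simp [fn_append]
  simp_rw [key]
  apply Summable.abs
  apply summable_sum
  intro q _
  apply Summable.mul_left
  exact (summable_abs_iff.1 hf).comp_injective (List.append_left_injective q)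

theorem IsMinimal.summable_suf {A : WFA α n} (hA : A.IsMinimal)
    (hf : Summable fun x => |A.fn x|) (i : Fin n) : Summable fun x => |A.suf x i| := by
  have h := hA.rev.summable_pre (by
    simp_rw [fn_rev]
    exact hf.comp_injective List.reverse_injective) i
  have h2 := h.comp_injective (List.reverse_injective)
  refine h2.congr fun x => ?_
  rw [Function.comp, ← suf_rev, rev_rev]

end WFA

/-! ### Sums over words and Gram matrices in `ℓ²` -/

theorem Summable.mul_of_abs {ι : Type*} {f g : ι → ℝ} (hf : Summable fun x => |f x|)
    (hg : Summable fun x => |g x|) : Summable fun x => f x * g x :=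
  (summable_mul_of_summable_norm (f := f) (g := g) hf hg).comp_injective
    (i := fun x => (x, x)) fun _ _ h => congrArg Prod.fst h

/-- A word is empty or has a first letter. -/
def listEquivSum (α : Type*) : List α ≃ Unit ⊕ (α × List α) where
  toFun
    | [] => .inl ()
    | a :: x => .inr (a, x)
  invFun
    | .inl _ => []
    | .inr (a, x) => a :: x
  left_inv x := by cases x <;> rfl
  right_inv x := by rcases x with _ | ⟨a, x⟩ <;> rfl

theorem tsum_list {α : Type*} [Fintype α] {g : List α → ℝ} (hg : Summable g) :
    ∑' x, g x = g [] + ∑ a, ∑' x, g (a :: x) := by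
  have h2 : Summable fun p : α × List α => g (p.1 :: p.2) :=
    hg.comp_injective (i := fun p : α × List α => p.1 :: p.2) fun p q h => by
      ext1
      · exact (List.cons.inj h).1
      · exact (List.cons.inj h).2
  have h3 : ∑' p : α × List α, g (p.1 :: p.2) = ∑ a, ∑' x, g (a :: x) := by
    rw [h2.tsum_prod, tsum_fintype]
  rw [← (listEquivSum α).symm.tsum_eq g, ← h3]
  have h4 := Summable.tsum_sum (f := fun p => g ((listEquivSum α).symm p))
    (Summable.of_finite) h2
  rw [h4]
  congr 1
  rw [tsum_fintype]
  exact Fintype.sum_unique _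

/-- `v` has Gram matrix `G` in `ℓ²`. -/
def HasGram {I : Type*} {n : ℕ} (v : I → Fin n → ℝ) (G : Matrix (Fin n) (Fin n) ℝ) : Prop :=
  ∀ i j, HasSum (fun x => v x i * v x j) (G i j)

namespace HasGram

variable {I : Type*} {n m : ℕ} {v : I → Fin n → ℝ} {G : Matrix (Fin n) (Fin n) ℝ}

theorem of_summable_abs (h : ∀ i, Summable fun x => |v x i|) :
    HasGram v (Matrix.of fun i j => ∑' x, v x i * v x j) :=
  fun i j => ((h i).mul_of_abs (h j)).hasSum

theorem mulVec (h : HasGram v G) (L : Matrix (Fin m) (Fin n) ℝ) :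
    HasGram (fun x => L *ᵥ v x) (L * G * Lᵀ) := by
  intro i j
  have h1 : HasSum (fun x => ∑ l, ∑ k, L i k * L j l * (v x k * v x l))
      (∑ l, ∑ k, L i k * L j l * G k l) :=
    hasSum_sum fun l _ => hasSum_sum fun k _ => (h k l).mul_left _
  convert h1 using 1
  · funext x
    simp only [Matrix.mulVec, dotProduct]
    rw [Finset.sum_mul_sum, Finset.sum_comm]
    exact sum_congr rfl fun _ _ => sum_congr rfl fun _ _ => by ring
  · simp only [Matrix.mul_apply, Matrix.transpose_apply, Finset.sum_mul]
    exact sum_congr rfl fun _ _ => sum_congr rfl fun _ _ => by ring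

theorem quad (h : HasGram v G) (y : Fin n → ℝ) :
    HasSum (fun x => (y ⬝ᵥ v x) ^ 2) (y ⬝ᵥ (G *ᵥ y)) := by
  have h1 : HasSum (fun x => ∑ k, ∑ l, y k * y l * (v x k * v x l))
      (∑ k, ∑ l, y k * y l * G k l) :=
    hasSum_sum fun k _ => hasSum_sum fun l _ => (h k l).mul_left _
  convert h1 using 1
  · funext x
    simp only [dotProduct, sq, Finset.sum_mul_sum]
    exact sum_congr rfl fun _ _ => sum_congr rfl fun _ _ => by ring
  · simp only [Matrix.mulVec, dotProduct, Finset.mul_sum]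
    exact sum_congr rfl fun _ _ => sum_congr rfl fun _ _ => by ring

theorem isSymm (h : HasGram v G) : Gᵀ = G := by
  ext i j
  rw [Matrix.transpose_apply]
  refine (h j i).unique ?_
  simpa [mul_comm] using h i j

theorem posDef (h : HasGram v G) (hv : ∀ y, (∀ x, y ⬝ᵥ v x = 0) → y = 0) : G.PosDef := by
  refine Matrix.PosDef.of_dotProduct_mulVec_pos (by
    rw [Matrix.IsHermitian, Matrix.conjTranspose_eq_transpose_of_trivial, h.isSymm]) ?_
  intro y hy
  rw [star_trivial]
  have hq := h.quad y
  -- A vanishing form is a vanishing sum of squares, so `y` is orthogonal to every `v x`.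
  refine lt_of_le_of_ne (hq.nonneg fun x => sq_nonneg _) fun h0 => hy (hv y fun x => ?_)
  rw [← h0] at hq
  have := (hasSum_zero_iff_of_nonneg fun x => sq_nonneg _).1 hq
  simpa using congrFun this x

theorem reverse {α : Type*} {v : List α → Fin n → ℝ} (h : HasGram v G) :
    HasGram (fun x : List α => v x.reverse) G := by
  intro i j
  have := (Equiv.hasSum_iff (List.reverse_involutive (α := α)).toPerm).2 (h i j)
  exact this

end HasGram

/-! ### The computed matrices are the Gram matrices -/

namespace WFA

variable {α : Type*} [Fintype α] {n : ℕ}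

/-- The Stein equation for the Gram matrix of the backward vectors. -/
theorem stein_suf (A : WFA α n) {G : Matrix (Fin n) (Fin n) ℝ} (h : HasGram A.suf G) :
    G = Matrix.vecMulVec A.final A.final + ∑ a, A.trans a * G * (A.trans a)ᵀ := by
  ext i j
  rw [← (h i j).tsum_eq, tsum_list (h i j).summable, Matrix.add_apply, Matrix.sum_apply]
  congr 1
  · simp [Matrix.vecMulVec_apply]
  · refine sum_congr rfl fun a _ => ?_
    simp only [suf_cons]
    exact (h.mulVec (A.trans a) i j).tsum_eq

/-- The number `1` exceeds the spectral radius of the complexified matrix, hence is not in its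
spectrum; nonvanishing of the determinant descends to `ℝ`. -/
theorem isUnit_one_sub_tensorSq {A : WFA α n} (h : matrixSpectralRadius A.tensorSq < 1) :
    IsUnit (1 - A.tensorSq).det := by
  have h1 : (1 : ℂ) ∈ resolventSet ℂ (A.tensorSq.map Complex.ofReal) :=
    spectrum.mem_resolventSet_of_spectralRadius_lt (by simpa [matrixSpectralRadius] using h)
  rw [spectrum.mem_resolventSet_iff, map_one, Matrix.isUnit_iff_isUnit_det] at h1
  have h2 : (1 : Matrix (Fin n × Fin n) (Fin n × Fin n) ℂ) - A.tensorSq.map Complex.ofReal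
      = Complex.ofRealHom.mapMatrix (1 - A.tensorSq) := by
    rw [map_sub, map_one]; rfl
  rw [h2, ← RingHom.map_det] at h1
  rw [isUnit_iff_ne_zero] at h1 ⊢
  intro h0
  exact h1 (by rw [h0]; simp)

/-- Vectorised, the Stein equation reads `(I - A^⊗) vec G = α_∞ ⊗ α_∞`, and the matrix on the left
is invertible. -/
theorem gramS_eq {A : WFA α n} (hρ : matrixSpectralRadius A.tensorSq < 1)
    {G : Matrix (Fin n) (Fin n) ℝ} (h : HasGram A.suf G) : A.gramS = G := by
  have hu := isUnit_one_sub_tensorSq hρ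
  have key : (fun k : Fin n × Fin n => A.final k.1 * A.final k.2) =
      (1 - A.tensorSq) *ᵥ (fun k : Fin n × Fin n => G k.1 k.2) := by
    funext ⟨i, j⟩
    rw [Matrix.sub_mulVec, Matrix.one_mulVec, Pi.sub_apply, eq_sub_iff_add_eq]
    conv_rhs => rw [A.stein_suf h]
    simp only [Matrix.add_apply, Matrix.vecMulVec_apply, Matrix.sum_apply, tensorSq,
      Matrix.sum_mulVec, Finset.sum_apply]
    congr 1
    refine sum_congr rfl fun a _ => ?_
    simp only [Matrix.mulVec, dotProduct, Matrix.mul_apply, Matrix.transpose_apply,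
      Finset.sum_mul, Matrix.kroneckerMap_apply, Fintype.sum_prod_type]
    rw [Finset.sum_comm]
    exact sum_congr rfl fun _ _ => sum_congr rfl fun _ _ => by ring
  ext i j
  rw [gramS, Matrix.of_apply, key, Matrix.mulVec_mulVec, Matrix.nonsing_inv_mul _ hu,
    Matrix.one_mulVec]

theorem tensorSq_rev (A : WFA α n) : A.rev.tensorSq = A.tensorSqᵀ := by
  simp only [tensorSq, rev, Matrix.transpose_sum, Matrix.kroneckerMap_transpose]

theorem gramP_eq_gramS_rev (A : WFA α n) : A.gramP = A.rev.gramS := by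
  ext i j
  rw [gramP, gramS, tensorSq_rev, Matrix.of_apply, Matrix.of_apply]
  rw [show (1 - A.tensorSqᵀ) = (1 - A.tensorSq)ᵀ by simp, ← Matrix.transpose_nonsing_inv,
    Matrix.mulVec_transpose]
  rfl

theorem matrixSpectralRadius_transpose {ι : Type*} [Fintype ι] [DecidableEq ι]
    (M : Matrix ι ι ℝ) : matrixSpectralRadius Mᵀ = matrixSpectralRadius M := by
  have h : ∀ N : Matrix ι ι ℂ, spectrum ℂ Nᵀ = spectrum ℂ N := by
    intro N
    ext k
    rw [spectrum.mem_iff, spectrum.mem_iff, Matrix.isUnit_iff_isUnit_det,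
      Matrix.isUnit_iff_isUnit_det, ← Matrix.det_transpose]
    simp [Matrix.algebraMap_eq_diagonal]
  rw [matrixSpectralRadius, matrixSpectralRadius, spectralRadius, spectralRadius,
    Matrix.transpose_map, h]

theorem gramP_eq {A : WFA α n} (hρ : matrixSpectralRadius A.tensorSq < 1)
    {G : Matrix (Fin n) (Fin n) ℝ} (h : HasGram A.pre G) : A.gramP = G := by
  rw [gramP_eq_gramS_rev]
  apply gramS_eq
  · rwa [tensorSq_rev, matrixSpectralRadius_transpose]
  · rw [show A.rev.suf = fun x => A.pre x.reverse from funext A.suf_rev]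
    exact h.reverse

end WFA

/-! ### Spectral and singular value decompositions of square matrices -/

section FiniteSVD

variable {n : ℕ}

theorem IsSpectralDecomposition.transpose_mul_self {G W : Matrix (Fin n) (Fin n) ℝ}
    {d : Fin n → ℝ} (h : IsSpectralDecomposition G W d) : Wᵀ * W = 1 :=
  (Matrix.mem_orthogonalGroup_iff' (Fin n) ℝ).1 h.1

theorem exists_isSpectralDecomposition {G : Matrix (Fin n) (Fin n) ℝ} (hG : G.IsHermitian) :
    ∃ W d, IsSpectralDecomposition G W d := by
  refine ⟨hG.eigenvectorUnitary, hG.eigenvalues, hG.eigenvectorUnitary.2, ?_⟩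
  conv_lhs => rw [hG.spectral_theorem, Unitary.conjStarAlgAut_apply]
  rfl

theorem IsSpectralDecomposition.pos {G W : Matrix (Fin n) (Fin n) ℝ} {d : Fin n → ℝ}
    (h : IsSpectralDecomposition G W d) (hG : G.PosDef) (i : Fin n) : 0 < d i := by
  have hW := h.transpose_mul_self
  have h1 : Wᵀ * G * W = Matrix.diagonal d := by
    rw [h.2]
    calc Wᵀ * (W * Matrix.diagonal d * Wᵀ) * W
        = (Wᵀ * W) * Matrix.diagonal d * (Wᵀ * W) := by simp only [Matrix.mul_assoc]
      _ = Matrix.diagonal d := by rw [hW, Matrix.one_mul, Matrix.mul_one]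
  have h2 : (Wᵀ * G * W).PosDef := by
    have := hG.conjTranspose_mul_mul_same (B := W) (by
      intro x y hxy
      have := congrArg (Wᵀ *ᵥ ·) hxy
      simpa [Matrix.mulVec_mulVec, hW] using this)
    simpa [Matrix.conjTranspose_eq_transpose_of_trivial] using this
  rw [h1] at h2
  exact Matrix.posDef_diagonal_iff.1 h2 i

/-- The eigenvalues of a spectral decomposition can be sorted decreasingly. -/
theorem exists_antitone_isSpectralDecomposition {G : Matrix (Fin n) (Fin n) ℝ}
    (hG : G.IsHermitian) : ∃ W d, Antitone d ∧ IsSpectralDecomposition G W d := by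
  obtain ⟨W, d, h⟩ := exists_isSpectralDecomposition hG
  have hW := h.transpose_mul_self
  let σ : Equiv.Perm (Fin n) := Tuple.sort (fun i => - d i)
  refine ⟨W.submatrix id σ, d ∘ σ, ?_, ?_, ?_⟩
  · intro i j hij
    have := Tuple.monotone_sort (fun i => - d i) hij
    simpa using this
  · rw [Matrix.mem_orthogonalGroup_iff', Matrix.transpose_submatrix,
      Matrix.submatrix_mul _ _ _ id _ Function.bijective_id |>.symm, hW]
    simp
  · conv_lhs => rw [h.2]
    ext i j
    rw [Matrix.mul_apply, Matrix.mul_apply]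
    simp only [Matrix.mul_diagonal, Matrix.transpose_apply, Matrix.submatrix_apply, id,
      Function.comp]
    exact (Equiv.sum_comp σ fun k => W i k * d k * W j k).symm

theorem isReducedSVD_iff {M U V : Matrix (Fin n) (Fin n) ℝ} {d : Fin n → ℝ} :
    IsReducedSVD M U d V ↔ (∀ i, 0 < d i) ∧ Antitone d ∧ Uᵀ * U = 1 ∧ Vᵀ * V = 1 ∧
      M = U * Matrix.diagonal d * Vᵀ := by
  have key : ∀ W : Matrix (Fin n) (Fin n) ℝ,
      (∀ i j, HasSum (fun x => W x i * W x j) (if i = j then 1 else 0)) ↔ Wᵀ * W = 1 := by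
    intro W
    rw [← Matrix.ext_iff]
    refine forall_congr' fun i => forall_congr' fun j => ?_
    rw [Matrix.mul_apply, Matrix.one_apply]
    simp only [Matrix.transpose_apply]
    exact ⟨fun h => (hasSum_fintype _).unique h, fun h => h ▸ hasSum_fintype _⟩
  have keq : (∀ x y, M x y = ∑ i, U x i * d i * V y i) ↔ M = U * Matrix.diagonal d * Vᵀ := by
    rw [← Matrix.ext_iff]
    refine forall_congr' fun i => forall_congr' fun j => ?_
    rw [Matrix.mul_apply]
    simp [Matrix.mul_diagonal]
  constructor
  · rintro ⟨h1, h2, h3, h4, h5⟩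
    exact ⟨h1, h2, (key U).1 h3, (key V).1 h4, keq.1 h5⟩
  · rintro ⟨h1, h2, h3, h4, h5⟩
    exact ⟨h1, h2, (key U).2 h3, (key V).2 h4, keq.2 h5⟩

/-- Diagonalise `MᵀM = V diag(e) Vᵀ` with `e` decreasing; then `d = √e` and `U = M V diag(√e)⁻¹`. -/
theorem exists_isReducedSVD {M : Matrix (Fin n) (Fin n) ℝ} (hM : IsUnit M) :
    ∃ (U : Matrix (Fin n) (Fin n) ℝ) (d : Fin n → ℝ) (V : Matrix (Fin n) (Fin n) ℝ),
      IsReducedSVD M U d V := by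
  have hP : (Mᵀ * M).PosDef := by
    have := Matrix.PosDef.conjTranspose_mul_self M (Matrix.mulVec_injective_of_isUnit hM)
    rwa [Matrix.conjTranspose_eq_transpose_of_trivial] at this
  obtain ⟨V, e, he, h⟩ := exists_antitone_isSpectralDecomposition hP.1
  have hV := h.transpose_mul_self
  have hV' : V * Vᵀ = 1 := mul_eq_one_comm.1 hV
  have hpos : ∀ i, 0 < e i := h.pos hP
  have hs : ∀ i, √(e i) ≠ 0 := fun i => (Real.sqrt_pos.2 (hpos i)).ne'
  refine ⟨M * V * Matrix.diagonal fun i => (√(e i))⁻¹, fun i => √(e i), V,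
    isReducedSVD_iff.2 ⟨fun i => Real.sqrt_pos.2 (hpos i),
      fun i j hij => Real.sqrt_le_sqrt (he hij), ?_, hV, ?_⟩⟩
  · calc _ = Matrix.diagonal (fun i => (√(e i))⁻¹) * (Vᵀ * (Mᵀ * M) * V) *
          Matrix.diagonal (fun i => (√(e i))⁻¹) := by
          simp only [Matrix.transpose_mul, Matrix.diagonal_transpose, Matrix.mul_assoc]
      _ = Matrix.diagonal (fun i => (√(e i))⁻¹) * ((Vᵀ * V) * Matrix.diagonal e * (Vᵀ * V)) *
          Matrix.diagonal (fun i => (√(e i))⁻¹) := by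
          rw [h.2]; simp only [Matrix.mul_assoc]
      _ = 1 := by
          rw [hV, Matrix.one_mul, Matrix.mul_one, Matrix.diagonal_mul_diagonal,
            Matrix.diagonal_mul_diagonal, ← Matrix.diagonal_one]
          congr 1
          funext i
          field_simp [hs i]
          exact (Real.sq_sqrt (hpos i).le).symm
  · calc M = M * (V * Vᵀ) := by rw [hV', Matrix.mul_one]
      _ = M * V * (Matrix.diagonal (fun i => (√(e i))⁻¹) * Matrix.diagonal fun i => √(e i)) *
          Vᵀ := by
          rw [Matrix.diagonal_mul_diagonal]
          simp only [inv_mul_cancel₀ (hs _), Matrix.diagonal_one, Matrix.mul_one, Matrix.mul_assoc]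
      _ = _ := by simp only [Matrix.mul_assoc]

end FiniteSVD

/-! ### Singular value automata -/

namespace WFA

variable {α : Type*} {n : ℕ}

/-- `A` is a singular value automaton: both Gram matrices equal `diag(d)` with
`d₁ ≥ ⋯ ≥ d_n > 0`. -/
structure IsSVA (A : WFA α n) (d : Fin n → ℝ) : Prop where
  pos : ∀ i, 0 < d i
  antitone : Antitone d
  gram_pre : HasGram A.pre (Matrix.diagonal d)
  gram_suf : HasGram A.suf (Matrix.diagonal d)

section Transform

variable (A : WFA α n) {L R : Matrix (Fin n) (Fin n) ℝ}

theorem word_transform (h : L * R = 1) (x : List α) :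
    (A.transform L R).word x = L * A.word x * R := by
  have h' : R * L = 1 := mul_eq_one_comm.1 h
  induction x with
  | nil => simp [h]
  | cons a x ih =>
    rw [word_cons, ih, word_cons]
    calc L * A.trans a * R * (L * A.word x * R)
        = L * A.trans a * (R * L) * A.word x * R := by simp only [Matrix.mul_assoc]
      _ = _ := by rw [h', Matrix.mul_one]; simp only [Matrix.mul_assoc]

theorem suf_transform (h : L * R = 1) (x : List α) :
    (A.transform L R).suf x = L *ᵥ A.suf x := by
  have h' : R * L = 1 := mul_eq_one_comm.1 h
  rw [suf, word_transform A h, transform, Matrix.mulVec_mulVec, Matrix.mul_assoc, h',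
    Matrix.mul_one, suf, Matrix.mulVec_mulVec]

theorem pre_transform (h : L * R = 1) (x : List α) :
    (A.transform L R).pre x = Rᵀ *ᵥ A.pre x := by
  have h' : R * L = 1 := mul_eq_one_comm.1 h
  rw [pre, word_transform A h, transform, Matrix.mulVec_transpose, Matrix.vecMul_vecMul,
    ← Matrix.mul_assoc, ← Matrix.mul_assoc, h', Matrix.one_mul, Matrix.mulVec_transpose, pre,
    Matrix.vecMul_vecMul]

theorem fn_transform (h : L * R = 1) : (A.transform L R).fn = A.fn := by
  have h' : R * L = 1 := mul_eq_one_comm.1 h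
  funext x
  rw [fn_eq_init_suf, suf_transform A h, fn_eq_init_suf, transform, Matrix.mulVec_transpose,
    Matrix.dotProduct_mulVec, Matrix.vecMul_vecMul, h', Matrix.vecMul_one]

end Transform

theorem diagonal_mul_diagonal_eq_one {a b : Fin n → ℝ} (h : ∀ i, a i * b i = 1) :
    Matrix.diagonal a * Matrix.diagonal b = 1 := by
  rw [Matrix.diagonal_mul_diagonal, ← Matrix.diagonal_one]
  congr 1
  exact funext h

/-- The change of basis computed from spectral decompositions of the Gram matrices turns an
automaton into a singular value automaton for the same function. -/
theorem isSVA_transform (A : WFA α n) {Gp Gs Vp Vs U V : Matrix (Fin n) (Fin n) ℝ}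
    {dp ds d : Fin n → ℝ} (hp : HasGram A.pre Gp) (hs : HasGram A.suf Gs)
    (hdp : ∀ i, 0 < dp i) (hds : ∀ i, 0 < ds i)
    (hGp : IsSpectralDecomposition Gp Vp dp) (hGs : IsSpectralDecomposition Gs Vs ds)
    (hM : IsReducedSVD
      (Matrix.diagonal (fun i => √(dp i)) * Vpᵀ * Vs * Matrix.diagonal (fun i => √(ds i)))
      U d V) :
    IsSVA (A.transform
      (Matrix.diagonal (fun i => √(d i)) *
        (Vs * Matrix.diagonal (fun i => (√(ds i))⁻¹) * V)ᵀ)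
      ((Vp * Matrix.diagonal (fun i => (√(dp i))⁻¹) * U) *
        Matrix.diagonal (fun i => √(d i)))) d ∧
    (A.transform
      (Matrix.diagonal (fun i => √(d i)) *
        (Vs * Matrix.diagonal (fun i => (√(ds i))⁻¹) * V)ᵀ)
      ((Vp * Matrix.diagonal (fun i => (√(dp i))⁻¹) * U) *
        Matrix.diagonal (fun i => √(d i)))).fn = A.fn := by
  obtain ⟨hd, hanti, hU, hV, hMeq⟩ := isReducedSVD_iff.1 hM
  have hVp := hGp.transpose_mul_self
  have hVs := hGs.transpose_mul_self
  have hVp' : Vp * Vpᵀ = 1 := mul_eq_one_comm.1 hVp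
  have hVs' : Vs * Vsᵀ = 1 := mul_eq_one_comm.1 hVs
  have hV' : V * Vᵀ = 1 := mul_eq_one_comm.1 hV
  have hne : ∀ {t : ℝ}, 0 < t → √t ≠ 0 := fun h => (Real.sqrt_pos.2 h).ne'
  set P := Matrix.diagonal (fun i => √(dp i))
  set P' := Matrix.diagonal (fun i => (√(dp i))⁻¹)
  set S := Matrix.diagonal (fun i => √(ds i))
  set S' := Matrix.diagonal (fun i => (√(ds i))⁻¹)
  set D := Matrix.diagonal (fun i => √(d i))
  have hPP' : P * P' = 1 := diagonal_mul_diagonal_eq_one fun i => mul_inv_cancel₀ (hne (hdp i))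
  have hP'P : P' * P = 1 := mul_eq_one_comm.1 hPP'
  have hSS' : S * S' = 1 := diagonal_mul_diagonal_eq_one fun i => mul_inv_cancel₀ (hne (hds i))
  have hS'S : S' * S = 1 := mul_eq_one_comm.1 hSS'
  have hP'T : P'ᵀ = P' := Matrix.diagonal_transpose _
  have hS'T : S'ᵀ = S' := Matrix.diagonal_transpose _
  have hDT : Dᵀ = D := Matrix.diagonal_transpose _
  have hsq : ∀ e : Fin n → ℝ, (∀ i, 0 < e i) →
      Matrix.diagonal e = Matrix.diagonal (fun i => √(e i)) * Matrix.diagonal (fun i => √(e i)) := by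
    intro e he
    rw [Matrix.diagonal_mul_diagonal]
    congr 1
    exact funext fun i => (Real.mul_self_sqrt (he i).le).symm
  have hdp2 : Matrix.diagonal dp = P * P := hsq dp hdp
  have hds2 : Matrix.diagonal ds = S * S := hsq ds hds
  have hd2 : Matrix.diagonal d = D * D := hsq d hd
  have hDinv : D * Matrix.diagonal (fun i => (√(d i))⁻¹) = 1 :=
    diagonal_mul_diagonal_eq_one fun i => mul_inv_cancel₀ (hne (hd i))
  set D' := Matrix.diagonal (fun i => (√(d i))⁻¹)
  have hD'D : D' * D = 1 := mul_eq_one_comm.1 hDinv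
  -- Both sides invert the matrix whose SVD was taken; `D` here is `diag(√d)`, so `D' * D'` is
  -- `diag(d)⁻¹`. This is the middle factor of `L * R`.
  have hinv : S' * Vsᵀ * Vp * P' = V * D' * D' * Uᵀ := by
    have h1 : (P * Vpᵀ * Vs * S) * (S' * Vsᵀ * Vp * P') = 1 := by
      calc _ = P * Vpᵀ * Vs * (S * S') * Vsᵀ * Vp * P' := by simp only [Matrix.mul_assoc]
        _ = P * Vpᵀ * (Vs * Vsᵀ) * Vp * P' := by
            rw [hSS', Matrix.mul_one]; simp only [Matrix.mul_assoc]
        _ = P * (Vpᵀ * Vp) * P' := by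
            rw [hVs', Matrix.mul_one]; simp only [Matrix.mul_assoc]
        _ = 1 := by rw [hVp, Matrix.mul_one, hPP']
    have h2 : (V * D' * D' * Uᵀ) * (P * Vpᵀ * Vs * S) = 1 := by
      rw [hMeq, hd2]
      calc _ = V * D' * (D' * (Uᵀ * U) * D) * D * Vᵀ := by simp only [Matrix.mul_assoc]
        _ = 1 := by
            rw [hU, Matrix.mul_one, hD'D, Matrix.mul_one, Matrix.mul_assoc V, hD'D,
              Matrix.mul_one, hV']
    exact (left_inv_eq_right_inv h2 h1).symm
  have hLR : (D * (Vs * S' * V)ᵀ) * (Vp * P' * U * D) = 1 := by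
    calc _ = D * Vᵀ * (S' * Vsᵀ * Vp * P') * U * D := by
          simp only [Matrix.transpose_mul, hS'T, Matrix.mul_assoc]
      _ = D * (Vᵀ * V) * D' * D' * (Uᵀ * U) * D := by
          rw [hinv]; simp only [Matrix.mul_assoc]
      _ = (D * D') * (D' * D) := by
          rw [hV, hU, Matrix.mul_one, Matrix.mul_one]; simp only [Matrix.mul_assoc]
      _ = 1 := by rw [hDinv, hD'D, Matrix.mul_one]
  refine ⟨⟨hd, hanti, ?_, ?_⟩, fn_transform A hLR⟩
  -- Forward vectors transform by `Rᵀ`, so their Gram matrix becomes `Rᵀ G_p R`.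
  · have h := hp.mulVec (Vp * P' * U * D)ᵀ
    rw [← show (A.transform (D * (Vs * S' * V)ᵀ) (Vp * P' * U * D)).pre = _ from
      funext (pre_transform A hLR)] at h
    convert h using 1
    rw [hGp.2, hdp2, hd2]
    symm
    calc _ = D * Uᵀ * P' * (Vpᵀ * Vp) * P * P * (Vpᵀ * Vp) * P' * U * D := by
          simp only [Matrix.transpose_mul, hP'T, hDT, Matrix.transpose_transpose,
            Matrix.mul_assoc]
      _ = D * Uᵀ * (P' * P) * (P * P') * U * D := by
          rw [hVp, Matrix.mul_one, Matrix.mul_one]; simp only [Matrix.mul_assoc]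
      _ = D * (Uᵀ * U) * D := by
          rw [hP'P, hPP', Matrix.mul_one, Matrix.mul_one]; simp only [Matrix.mul_assoc]
      _ = D * D := by rw [hU, Matrix.mul_one]
  · have h := hs.mulVec (D * (Vs * S' * V)ᵀ)
    rw [← show (A.transform (D * (Vs * S' * V)ᵀ) (Vp * P' * U * D)).suf = _ from
      funext (suf_transform A hLR)] at h
    convert h using 1
    rw [hGs.2, hds2, hd2]
    symm
    calc _ = D * Vᵀ * S' * (Vsᵀ * Vs) * S * S * (Vsᵀ * Vs) * S' * V * D := by
          simp only [Matrix.transpose_mul, hS'T, hDT, Matrix.transpose_transpose,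
            Matrix.mul_assoc]
      _ = D * Vᵀ * (S' * S) * (S * S') * V * D := by
          rw [hVs, Matrix.mul_one, Matrix.mul_one]; simp only [Matrix.mul_assoc]
      _ = D * (Vᵀ * V) * D := by
          rw [hS'S, hSS', Matrix.mul_one, Matrix.mul_one]; simp only [Matrix.mul_assoc]
      _ = D * D := by rw [hV, Matrix.mul_one]

/-- The decompositions used to build a singular value automaton exist. -/
theorem exists_decompositions {Gp Gs : Matrix (Fin n) (Fin n) ℝ} (hp : Gp.PosDef)
    (hs : Gs.PosDef) :
    ∃ (Vp Vs U V : Matrix (Fin n) (Fin n) ℝ) (dp ds d : Fin n → ℝ),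
      IsSpectralDecomposition Gp Vp dp ∧ IsSpectralDecomposition Gs Vs ds ∧
      IsReducedSVD
        (Matrix.diagonal (fun i => √(dp i)) * Vpᵀ * Vs * Matrix.diagonal (fun i => √(ds i)))
        U d V := by
  obtain ⟨Vp, dp, h1⟩ := exists_isSpectralDecomposition hp.1
  obtain ⟨Vs, ds, h2⟩ := exists_isSpectralDecomposition hs.1
  have hdiag : ∀ e : Fin n → ℝ, (∀ i, 0 < e i) → IsUnit (Matrix.diagonal fun i => √(e i)) :=
    fun e he => IsUnit.of_mul_eq_one _ (diagonal_mul_diagonal_eq_one (b := fun i => (√(e i))⁻¹)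
      fun i => mul_inv_cancel₀ (Real.sqrt_pos.2 (he i)).ne')
  have hu : IsUnit
      (Matrix.diagonal (fun i => √(dp i)) * Vpᵀ * Vs * Matrix.diagonal (fun i => √(ds i))) :=
    (((hdiag dp (h1.pos hp)).mul (IsUnit.of_mul_eq_one _ h1.transpose_mul_self)).mul
      (IsUnit.of_mul_eq_one _ (mul_eq_one_comm.1 h2.transpose_mul_self))).mul
      (hdiag ds (h2.pos hs))
  obtain ⟨U, d, V, h3⟩ := exists_isReducedSVD hu
  exact ⟨Vp, Vs, U, V, dp, ds, d, h1, h2, h3⟩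

theorem IsMinimal.exists_gram {A : WFA α n} (hA : A.IsMinimal)
    (hf : Summable fun x => |A.fn x|) :
    ∃ Gp Gs, HasGram A.pre Gp ∧ HasGram A.suf Gs ∧ Gp.PosDef ∧ Gs.PosDef := by
  have hp := HasGram.of_summable_abs (hA.summable_pre hf)
  have hs := HasGram.of_summable_abs (hA.summable_suf hf)
  refine ⟨_, _, hp, hs, hp.posDef fun y hy => ?_, hs.posDef fun y hy => hA.eq_zero_of_suf hy⟩
  refine hA.rev.eq_zero_of_suf fun x => ?_
  rw [suf_rev]
  exact hy _

theorem IsMinimal.exists_isSVA {A : WFA α n} (hA : A.IsMinimal)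
    (hf : Summable fun x => |A.fn x|) :
    ∃ (B : WFA α n) (d : Fin n → ℝ), B.IsSVA d ∧ B.fn = A.fn := by
  obtain ⟨Gp, Gs, hp, hs, hp', hs'⟩ := hA.exists_gram hf
  obtain ⟨Vp, Vs, U, V, dp, ds, d, h1, h2, h3⟩ := exists_decompositions hp' hs'
  exact ⟨_, d, A.isSVA_transform hp hs (h1.pos hp') (h2.pos hs') h1 h2 h3⟩

theorem IsMinimal.exists_computeSVA [Fintype α] {A : WFA α n} (hA : A.IsMinimal)
    (hf : Summable fun x => |A.fn x|) (hρ : matrixSpectralRadius A.tensorSq < 1) :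
    ∃ A', ComputeSVA A A' := by
  obtain ⟨Gp, Gs, hp, hs, hp', hs'⟩ := hA.exists_gram hf
  obtain ⟨Vp, Vs, U, V, dp, ds, d, h1, h2, h3⟩ := exists_decompositions hp' hs'
  rw [← gramP_eq hρ hp] at h1
  rw [← gramS_eq hρ hs] at h2
  exact ⟨_, Vp, Vs, U, V, dp, ds, d, h1, h2, h3, rfl⟩

theorem IsMinimal.isSVA_of_computeSVA [Fintype α] {A A' : WFA α n} (hA : A.IsMinimal)
    (hf : Summable fun x => |A.fn x|) (hρ : matrixSpectralRadius A.tensorSq < 1)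
    (h : ComputeSVA A A') : ∃ d, A'.IsSVA d ∧ A'.fn = A.fn := by
  obtain ⟨Gp, Gs, hp, hs, hp', hs'⟩ := hA.exists_gram hf
  obtain ⟨Vp, Vs, U, V, dp, ds, d, h1, h2, h3, rfl⟩ := h
  rw [gramP_eq hρ hp] at h1
  rw [gramS_eq hρ hs] at h2
  exact ⟨d, A.isSVA_transform hp hs (h1.pos hp') (h2.pos hs') h1 h2 h3⟩

/-- A singular value automaton yields a reduced SVD of the Hankel matrix. -/
theorem IsSVA.isReducedSVD_hankel {A : WFA α n} {d : Fin n → ℝ} (h : A.IsSVA d) :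
    IsReducedSVD (hankel A.fn) (Matrix.of fun x i => A.pre x i / √(d i)) d
      (Matrix.of fun x i => A.suf x i / √(d i)) := by
  have hs : ∀ i, √(d i) ≠ 0 := fun i => (Real.sqrt_pos.2 (h.pos i)).ne'
  have key : ∀ v : List α → Fin n → ℝ, HasGram v (Matrix.diagonal d) → ∀ i j,
      HasSum (fun x => v x i / √(d i) * (v x j / √(d j))) (if i = j then 1 else 0) := by
    intro v hv i j
    have h1 := (hv i j).mul_left ((√(d i))⁻¹ * (√(d j))⁻¹)
    convert! h1 using 1
    · funext x
      ring
    · split_ifs with hij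
      · subst hij
        rw [Matrix.diagonal_apply_eq, ← mul_inv, Real.mul_self_sqrt (h.pos i).le,
          inv_mul_cancel₀ (h.pos i).ne']
      · rw [Matrix.diagonal_apply_ne _ hij, mul_zero]
  refine ⟨h.pos, h.antitone, key _ h.gram_pre, key _ h.gram_suf, fun x y => ?_⟩
  rw [hankel, Matrix.of_apply, fn_append, dotProduct]
  refine sum_congr rfl fun i _ => ?_
  have hsq : √(d i) * √(d i) = d i := Real.mul_self_sqrt (h.pos i).le
  simp only [Matrix.of_apply]
  field_simp [hs i]
  rw [sq, hsq]

end WFA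

/-! ### Uniqueness in reduced singular value decompositions -/

theorem summable_mul_of_summable_sq {I : Type*} {f g : I → ℝ} (hf : Summable fun x => f x * f x)
    (hg : Summable fun x => g x * g x) : Summable fun x => f x * g x := by
  refine Summable.of_norm_bounded (hf.add hg) fun x => ?_
  rw [Real.norm_eq_abs, abs_le]
  constructor <;> nlinarith [sq_nonneg (f x + g x), sq_nonneg (f x - g x), sq_nonneg (f x),
    sq_nonneg (g x)]

namespace IsReducedSVD

variable {I J : Type*} {n : ℕ} {M : Matrix I J ℝ} {U U' : Matrix I (Fin n) ℝ}
  {V V' : Matrix J (Fin n) ℝ} {s s' : Fin n → ℝ}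

theorem transpose (h : IsReducedSVD M U s V) : IsReducedSVD Mᵀ V s U where
  pos := h.pos
  antitone := h.antitone
  left_orthonormal := h.right_orthonormal
  right_orthonormal := h.left_orthonormal
  eq x y := by
    rw [Matrix.transpose_apply, h.eq]
    exact sum_congr rfl fun _ _ => by ring

theorem hasGram_left (h : IsReducedSVD M U s V) : HasGram U 1 := fun i j => by
  rw [Matrix.one_apply]; exact h.left_orthonormal i j

/-- The matrix of inner products of the columns of two matrices. -/
def cross (U U' : Matrix I (Fin n) ℝ) : Matrix (Fin n) (Fin n) ℝ :=
  Matrix.of fun i j => ∑' x, U x i * U' x j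

theorem hasSum_cross (h : IsReducedSVD M U s V) (h' : IsReducedSVD M U' s' V') (i j : Fin n) :
    HasSum (fun x => U x i * U' x j) (cross U U' i j) :=
  (summable_mul_of_summable_sq (h.left_orthonormal i i).summable
    (h'.left_orthonormal j j).summable).hasSum

/-- Pair the `i`-th column of `U` with the column `y` of `M`, expanded in each of the two
decompositions. -/
theorem mul_right_eq_sum_cross (h : IsReducedSVD M U s V) (h' : IsReducedSVD M U' s' V')
    (i : Fin n) (y : J) : s i * V y i = ∑ k, cross U U' i k * s' k * V' y k := by
  have h1 : HasSum (fun x => U x i * M x y) (∑ k, (if i = k then 1 else 0) * (s k * V y k)) := by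
    refine (hasSum_sum fun k (_ : k ∈ univ) =>
      (h.left_orthonormal i k).mul_right (s k * V y k)).congr_fun ?_
    intro x
    rw [h.eq, Finset.mul_sum]
    exact sum_congr rfl fun _ _ => by ring
  have h2 : HasSum (fun x => U x i * M x y) (∑ k, cross U U' i k * (s' k * V' y k)) := by
    refine (hasSum_sum fun k (_ : k ∈ univ) =>
      (h.hasSum_cross h' i k).mul_right (s' k * V' y k)).congr_fun ?_
    intro x
    rw [h'.eq, Finset.mul_sum]
    exact sum_congr rfl fun _ _ => by ring
  have h3 := h1.unique h2
  simp only [ite_mul, one_mul, zero_mul, sum_ite_eq, mem_univ, if_true] at h3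
  rw [h3]
  exact sum_congr rfl fun _ _ => by ring

theorem mul_cross_right (h : IsReducedSVD M U s V) (h' : IsReducedSVD M U' s' V')
    (i j : Fin n) : s i * cross V V' i j = cross U U' i j * s' j := by
  have h1 := (h.transpose.hasSum_cross h'.transpose i j).mul_left (s i)
  have h2 : HasSum (fun y => s i * (V y i * V' y j))
      (∑ k, cross U U' i k * s' k * (if k = j then 1 else 0)) := by
    refine (hasSum_sum fun k (_ : k ∈ univ) =>
      (h'.right_orthonormal k j).mul_left (cross U U' i k * s' k)).congr_fun ?_
    intro y
    rw [← mul_assoc, h.mul_right_eq_sum_cross h', Finset.sum_mul]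
    exact sum_congr rfl fun _ _ => by ring
  have h3 := h1.unique h2
  simpa using h3

theorem right_eq_cross_mulVec (h : IsReducedSVD M U s V) (h' : IsReducedSVD M U' s' V')
    (y : J) : V y = cross V V' *ᵥ V' y := by
  funext i
  apply mul_left_cancel₀ (h.pos i).ne'
  rw [h.mul_right_eq_sum_cross h', Matrix.mulVec, dotProduct, Finset.mul_sum]
  exact sum_congr rfl fun k _ => by rw [← h.mul_cross_right h', mul_assoc]

/-- The cross matrix carries the rows of `V'` to those of `V`, and both have identity Gram matrix.
-/
theorem cross_mul_transpose (h : IsReducedSVD M U s V) (h' : IsReducedSVD M U' s' V') :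
    cross V V' * (cross V V')ᵀ = 1 := by
  have h1 := h'.transpose.hasGram_left.mulVec (cross V V')
  rw [Matrix.mul_one, ← show V = _ from funext (h.right_eq_cross_mulVec h')] at h1
  ext i j
  exact (h1 i j).unique (h.transpose.hasGram_left i j)

theorem mul_cross_left (h : IsReducedSVD M U s V) (h' : IsReducedSVD M U' s' V')
    (i j : Fin n) : s i * cross U U' i j = cross U U' i j * s' j := by
  have h1 := h.mul_cross_right h' i j
  have h2 := h.transpose.mul_cross_right h'.transpose i j
  have hi := h.pos i
  have hj := h'.pos j
  -- Eliminating the cross entry of `V`, `V'` gives `(s i² - s' j²) K i j = 0`, and `s i + s' j >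
  -- 0`.
  have h3 : (s i * cross U U' i j - cross U U' i j * s' j) * (s i + s' j) = 0 := by
    linear_combination s i * h2 + s' j * h1
  rcases mul_eq_zero.1 h3 with h4 | h4
  · linarith
  · linarith

/-- The singular values of a reduced SVD are unique. -/
theorem singularValues_unique (h : IsReducedSVD M U s V) (h' : IsReducedSVD M U' s' V') :
    s = s' := by
  have hdet : (cross U U').det ≠ 0 := by
    intro h0
    have := congrArg Matrix.det (h.transpose.cross_mul_transpose h'.transpose)
    rw [Matrix.det_mul, h0, zero_mul, Matrix.det_one] at this
    exact zero_ne_one this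
  rw [Matrix.det_apply] at hdet
  -- A nonzero Leibniz term gives a permutation along which every cross entry is nonzero, forcing `s
  -- (σ j) = s' j`. Decreasing rearrangements are unique.
  obtain ⟨σ, -, hσ⟩ := exists_ne_zero_of_sum_ne_zero hdet
  have hσ' : ∀ j, cross U U' (σ j) j ≠ 0 := by
    intro j hj
    exact hσ (by
      rw [prod_eq_zero (f := fun i => cross U U' (σ i) i) (mem_univ j) hj, smul_zero])
  have hs : s ∘ σ = s' := by
    funext j
    have := h.mul_cross_left h' (σ j) j
    rw [mul_comm] at this
    exact mul_left_cancel₀ (hσ' j) this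
  rw [← hs]
  have := Tuple.unique_antitone (f := s) (σ := 1) (τ := σ) h.antitone (hs ▸ h'.antitone)
  exact this

/-- The diagonal of the positive factor `U diag(s) Uᵀ` in the polar decomposition is unique. -/
theorem sum_mul_sq_unique (h : IsReducedSVD M U s V) (h' : IsReducedSVD M U' s' V') (x : I) :
    ∑ i, s i * U x i ^ 2 = ∑ i, s' i * U' x i ^ 2 := by
  set K := cross U U'
  have hKK : K * Kᵀ = 1 := h.transpose.cross_mul_transpose h'.transpose
  have hKK' : Kᵀ * K = 1 := mul_eq_one_comm.1 hKK
  have hU : U x = K *ᵥ U' x := h.transpose.right_eq_cross_mulVec h'.transpose x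
  have hD : Matrix.diagonal s * K = K * Matrix.diagonal s' := by
    ext i j
    rw [Matrix.diagonal_mul, Matrix.mul_diagonal]
    exact h.mul_cross_left h' i j
  have key : ∀ (t : Fin n → ℝ) (v : Fin n → ℝ),
      ∑ i, t i * v i ^ 2 = v ⬝ᵥ (Matrix.diagonal t *ᵥ v) := by
    intro t v
    simp only [dotProduct, Matrix.mulVec_diagonal]
    exact sum_congr rfl fun _ _ => by ring
  -- The orthogonal matrix `K` intertwines the two diagonal forms and maps `U' x` to `U x`.
  rw [key, key, hU, Matrix.mulVec_mulVec, hD, ← Matrix.mulVec_mulVec, Matrix.dotProduct_mulVec,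
    Matrix.vecMul_mulVec, hKK', Matrix.vecMul_one]

end IsReducedSVD

/-! ### Convolution on words -/

/-- Young's inequality for the convolution of an `ℓ¹` and an `ℓ²` function on words. -/
theorem tsum_sq_le_of_convolution {α : Type*} {a b e : List α → ℝ} (ha : ∀ x, 0 ≤ a x)
    (hsa : Summable a) (hsb : Summable fun x => b x ^ 2)
    (he : ∀ x, |e x| ≤ ∑ k ∈ range (x.length + 1), a (x.take k) * b (x.drop k)) :
    Summable (fun x => e x ^ 2) ∧
      ∑' x, e x ^ 2 ≤ (∑' x, a x) ^ 2 * ∑' x, b x ^ 2 := by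
  set L := ∑' x, a x
  have hL0 : 0 ≤ L := tsum_nonneg ha
  set F : List α × List α → ℝ := fun p => a p.1 * b p.2 ^ 2
  have hF0 : ∀ p, 0 ≤ F p := fun p => mul_nonneg (ha _) (sq_nonneg _)
  have hFs : Summable F := hsa.mul_of_nonneg hsb ha fun x => sq_nonneg _
  have hFsum : ∑' p, F p = L * ∑' x, b x ^ 2 := (hsa.tsum_mul_tsum hsb hFs).symm
  let ι : (Σ x : List α, Fin (x.length + 1)) → List α × List α :=
    fun p => (p.1.take p.2, p.1.drop p.2)
  -- The two pieces determine the word by concatenation and the cut by the length of the first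
  -- piece, as `k` is at most the length of `x`.
  have hι : Function.Injective ι := by
    rintro ⟨x, k⟩ ⟨y, l⟩ h
    obtain ⟨h1, h2⟩ := Prod.mk.inj h
    have hxy : x = y := by
      rw [← List.take_append_drop k x, ← List.take_append_drop l y]
      exact congrArg₂ _ h1 h2
    subst hxy
    have h3 := congrArg List.length h1
    simp only [List.length_take] at h3
    have hk := k.2
    have hl := l.2
    have : k = l := Fin.ext (by omega)
    rw [this]
  have hFι : Summable (F ∘ ι) := hFs.comp_injective hι
  have hcol : ∀ x : List α, ∑' k : Fin (x.length + 1), (F ∘ ι) ⟨x, k⟩ =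
      ∑ k ∈ range (x.length + 1), a (x.take k) * b (x.drop k) ^ 2 := by
    intro x
    rw [tsum_fintype, ← Fin.sum_univ_eq_sum_range (fun k => a (x.take k) * b (x.drop k) ^ 2)]
    rfl
  have hGs : Summable fun x : List α =>
      ∑ k ∈ range (x.length + 1), a (x.take k) * b (x.drop k) ^ 2 := by
    simpa only [hcol] using hFι.sigma
  have hGsum : ∑' x : List α, ∑ k ∈ range (x.length + 1), a (x.take k) * b (x.drop k) ^ 2 ≤
      L * ∑' x, b x ^ 2 := by
    rw [← hFsum, ← tsum_congr hcol, ← hFι.tsum_sigma]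
    exact tsum_comp_le_tsum_of_inj hFs hF0 hι
  have hpt : ∀ x, e x ^ 2 ≤
      L * ∑ k ∈ range (x.length + 1), a (x.take k) * b (x.drop k) ^ 2 := by
    intro x
    -- The prefixes of `x` are distinct words, so this is a partial sum of `a`.
    have h1 : ∑ k ∈ range (x.length + 1), a (x.take k) ≤ L := by
      have hinj : Set.InjOn (fun k => x.take k) (range (x.length + 1) : Set ℕ) := by
        intro k hk l hl h
        have h3 := congrArg List.length h
        simp only [List.length_take] at h3
        simp only [coe_range, Set.mem_Iio] at hk hl
        omega
      classical
      rw [← sum_image (f := a) hinj]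
      exact hsa.sum_le_tsum _ fun y _ => ha y
    calc e x ^ 2 = |e x| ^ 2 := (sq_abs _).symm
      _ ≤ (∑ k ∈ range (x.length + 1), a (x.take k) * b (x.drop k)) ^ 2 :=
          pow_le_pow_left₀ (abs_nonneg _) (he x) 2
      -- Cauchy–Schwarz with weights `a (x.take k)`.
      _ ≤ (∑ k ∈ range (x.length + 1), a (x.take k)) *
            ∑ k ∈ range (x.length + 1), a (x.take k) * b (x.drop k) ^ 2 :=
          sum_sq_le_sum_mul_sum_of_sq_le_mul _ (fun _ _ => ha _)
            (fun _ _ => mul_nonneg (ha _) (sq_nonneg _)) fun _ _ => by ring_nf; rfl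
      _ ≤ _ := mul_le_mul_of_nonneg_right h1
          (sum_nonneg fun _ _ => mul_nonneg (ha _) (sq_nonneg _))
  have hs : Summable fun x => e x ^ 2 :=
    Summable.of_nonneg_of_le (fun _ => sq_nonneg _) hpt (hGs.mul_left L)
  refine ⟨hs, ?_⟩
  calc ∑' x, e x ^ 2
      ≤ ∑' x : List α, L * ∑ k ∈ range (x.length + 1), a (x.take k) * b (x.drop k) ^ 2 :=
        hs.tsum_le_tsum hpt (hGs.mul_left L)
    _ = L * ∑' x : List α, ∑ k ∈ range (x.length + 1), a (x.take k) * b (x.drop k) ^ 2 :=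
        tsum_mul_left
    _ ≤ L * (L * ∑' x, b x ^ 2) := mul_le_mul_of_nonneg_left hGsum hL0
    _ = L ^ 2 * ∑' x, b x ^ 2 := by ring

/-! ### Truncation error of a singular value automaton -/

namespace WFA

variable {α : Type*} {n : ℕ}

/-- Set all coordinates from the `m`-th on to zero. -/
def keep (m : ℕ) (y : Fin n → ℝ) : Fin n → ℝ := fun i => if (i : ℕ) < m then y i else 0

theorem dotProduct_keep (m : ℕ) (y z : Fin n → ℝ) : y ⬝ᵥ keep m z = keep m y ⬝ᵥ z := by
  simp only [dotProduct, keep, mul_ite, mul_zero, ite_mul, zero_mul]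

theorem dotProduct_eq_keep_add (m : ℕ) (y z : Fin n → ℝ) :
    y ⬝ᵥ z = y ⬝ᵥ keep m z + ∑ i with m ≤ (i : Fin n).val, y i * z i := by
  rw [dotProduct, dotProduct, sum_filter, ← sum_add_distrib]
  refine sum_congr rfl fun i _ => ?_
  by_cases h : (i : ℕ) < m
  · simp [keep, h]
  · simp [keep, h, not_lt.1 h]

theorem truncMatrix_transpose_mulVec {m : ℕ} (z : Fin n → ℝ) :
    (truncMatrix m n)ᵀ *ᵥ (truncMatrix m n *ᵥ z) = keep m z := by
  have h1 : ∀ i : Fin m, ∀ hi : (i : ℕ) < n, (truncMatrix m n *ᵥ z) i = z ⟨i, hi⟩ := by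
    intro i hi
    simp only [Matrix.mulVec, dotProduct, truncMatrix, Matrix.of_apply, ite_mul, one_mul, zero_mul]
    rw [sum_eq_single ⟨i, hi⟩]
    · simp
    · intro b _ hb
      exact if_neg fun h => hb (Fin.ext h.symm)
    · simp
  funext j
  rw [Matrix.mulVec, dotProduct, keep]
  simp only [Matrix.transpose_apply, truncMatrix, Matrix.of_apply, ite_mul, one_mul, zero_mul]
  split_ifs with hj
  · rw [sum_eq_single ⟨j, hj⟩]
    · rw [if_pos rfl]
      exact h1 ⟨j, hj⟩ j.2
    · intro b _ hb
      exact if_neg fun h => hb (Fin.ext h)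
    · simp
  · refine sum_eq_zero fun b _ => if_neg fun h => hj ?_
    rw [← h]
    exact b.2

/-- The backward vectors of the automaton truncated to its first `m` states, before the last
projection. -/
def truncSuf (A : WFA α n) (m : ℕ) : List α → Fin n → ℝ
  | [] => A.final
  | a :: x => A.trans a *ᵥ keep m (A.truncSuf m x)

theorem suf_truncate (A : WFA α n) (m : ℕ) (x : List α) :
    (A.transform (truncMatrix m n) (truncMatrix m n)ᵀ).suf x =
      truncMatrix m n *ᵥ A.truncSuf m x := by
  induction x with
  | nil => simp [transform, truncSuf]
  | cons a x ih =>
    rw [suf_cons, ih, truncSuf, ← truncMatrix_transpose_mulVec]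
    simp [transform, Matrix.mulVec_mulVec, Matrix.mul_assoc]

theorem fn_truncate (A : WFA α n) (m : ℕ) (x : List α) :
    (A.transform (truncMatrix m n) (truncMatrix m n)ᵀ).fn x =
      A.init ⬝ᵥ keep m (A.truncSuf m x) := by
  rw [fn_eq_init_suf, suf_truncate, ← truncMatrix_transpose_mulVec, Matrix.dotProduct_mulVec,
    Matrix.dotProduct_mulVec, Matrix.dotProduct_mulVec, Matrix.vecMul_transpose]
  simp [transform]

/-- The truncation error telescopes over the positions at which a word can be cut. -/
theorem telescope (A : WFA α n) (m : ℕ) (x : List α) (o : Fin n → ℝ) :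
    (o ᵥ* A.word x) ⬝ᵥ A.final - o ⬝ᵥ keep m (A.truncSuf m x) =
      ∑ k ∈ range (x.length + 1), ∑ i with m ≤ (i : Fin n).val,
        (o ᵥ* A.word (x.take k)) i * A.truncSuf m (x.drop k) i := by
  induction x generalizing o with
  | nil =>
    rw [word_nil, Matrix.vecMul_one, truncSuf, dotProduct_eq_keep_add m o]
    simp [truncSuf]
  | cons a x ih =>
    -- The term `k = 0` is the cut before the first letter; the others are the cuts of the tail,
    -- with start vector advanced by `a`.
    rw [List.length_cons, sum_range_succ']
    simp only [List.take_succ_cons, List.drop_succ_cons, word_cons, ← Matrix.vecMul_vecMul,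
      List.take_zero, List.drop_zero, word_nil, Matrix.vecMul_one]
    rw [← ih, ← Matrix.dotProduct_mulVec o (A.trans a)]
    have h := dotProduct_eq_keep_add m o (A.truncSuf m (a :: x))
    rw [show A.truncSuf m (a :: x) = A.trans a *ᵥ keep m (A.truncSuf m x) from rfl] at h ⊢
    linarith

theorem fn_sub_fn_truncate (A : WFA α n) (m : ℕ) (x : List α) :
    A.fn x - (A.transform (truncMatrix m n) (truncMatrix m n)ᵀ).fn x =
      ∑ k ∈ range (x.length + 1), ∑ i with m ≤ (i : Fin n).val,
        A.pre (x.take k) i * A.truncSuf m (x.drop k) i := by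
  rw [fn_truncate, fn, Matrix.dotProduct_mulVec]
  exact A.telescope m x A.init

/-- The Stein equation of a singular value automaton as an identity of quadratic forms. -/
theorem IsSVA.stein [Fintype α] {A : WFA α n} {d : Fin n → ℝ} (h : A.IsSVA d)
    (y : Fin n → ℝ) :
    ∑ i, d i * y i ^ 2 = (y ⬝ᵥ A.final) ^ 2 + ∑ a, ∑ i, d i * (y ᵥ* A.trans a) i ^ 2 := by
  have key : ∀ z : Fin n → ℝ, HasSum (fun x => (z ⬝ᵥ A.suf x) ^ 2) (∑ i, d i * z i ^ 2) := by
    intro z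
    convert h.gram_suf.quad z using 1
    simp only [dotProduct, Matrix.mulVec_diagonal]
    exact sum_congr rfl fun _ _ => by ring
  rw [← (key y).tsum_eq, tsum_list (key y).summable, suf_nil]
  congr 1
  refine sum_congr rfl fun a _ => ?_
  rw [← (key _).tsum_eq]
  simp only [suf_cons, Matrix.dotProduct_mulVec]

/-- Without truncation and length bound, the Stein equation gives equality. Truncation replaces `y
ᵥ* A_a` by its projection at each letter, which can only lower the form. The length bound leaves
finitely many nonzero terms, so no convergence is presupposed, and permits induction. -/
theorem IsSVA.tsum_truncSuf_of_length_lt [Fintype α] {A : WFA α n} {d : Fin n → ℝ}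
    (h : A.IsSVA d) (m N : ℕ) (y : Fin n → ℝ) :
    ∑' x : List α, (if x.length < N then (y ⬝ᵥ A.truncSuf m x) ^ 2 else 0) ≤
      ∑ i, d i * y i ^ 2 := by
  induction N generalizing y with
  | zero =>
    simp only [not_lt_zero, if_false, tsum_zero]
    exact sum_nonneg fun i _ => mul_nonneg (h.pos i).le (sq_nonneg _)
  | succ N ih =>
    have hs : Summable fun x : List α =>
        (if x.length < N + 1 then (y ⬝ᵥ A.truncSuf m x) ^ 2 else 0) := by
      refine summable_of_hasFiniteSupport ((List.finite_length_lt α (N + 1)).subset ?_)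
      intro x hx
      by_contra hx'
      exact hx (if_neg hx')
    rw [tsum_list hs, h.stein y]
    simp only [List.length_nil, Nat.succ_pos, if_true, truncSuf, List.length_cons,
      Nat.add_lt_add_iff_right, Matrix.dotProduct_mulVec, dotProduct_keep m]
    refine add_le_add le_rfl (sum_le_sum fun a _ => (ih _).trans (sum_le_sum fun i _ => ?_))
    refine mul_le_mul_of_nonneg_left ?_ (h.pos i).le
    rw [keep]
    split_ifs
    · exact le_rfl
    · rw [zero_pow two_ne_zero]
      exact sq_nonneg _

theorem IsSVA.sum_truncSuf_le [Fintype α] {A : WFA α n} {d : Fin n → ℝ} (h : A.IsSVA d)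
    (m : ℕ) (i : Fin n) (F : Finset (List α)) : ∑ x ∈ F, A.truncSuf m x i ^ 2 ≤ d i := by
  set N := F.sup List.length + 1
  have hlt : ∀ x ∈ F, x.length < N := fun x hx =>
    Nat.lt_succ_of_le (Finset.le_sup (f := List.length) hx)
  have hs : Summable fun x : List α =>
      (if x.length < N then (Pi.single i 1 ⬝ᵥ A.truncSuf m x) ^ 2 else 0) := by
    refine summable_of_hasFiniteSupport ((List.finite_length_lt α N).subset ?_)
    intro x hx
    by_contra hx'
    exact hx (if_neg hx')
  calc ∑ x ∈ F, A.truncSuf m x i ^ 2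
      = ∑ x ∈ F, (if x.length < N then (Pi.single i 1 ⬝ᵥ A.truncSuf m x) ^ 2 else 0) := by
        refine sum_congr rfl fun x hx => ?_
        rw [if_pos (hlt x hx), single_one_dotProduct]
    _ ≤ _ := hs.sum_le_tsum F fun x _ => by
        split_ifs
        · exact sq_nonneg _
        · exact le_rfl
    _ ≤ ∑ j, d j * (Pi.single i 1 : Fin n → ℝ) j ^ 2 := h.tsum_truncSuf_of_length_lt m N _
    _ = d i := by
        rw [sum_eq_single i]
        · simp
        · intro j _ hj
          simp [hj]
        · simp

/-- The `ℓ²` error of truncating a singular value automaton is controlled by the sum of the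
discarded singular values. -/
theorem IsSVA.truncation_error [Fintype α] {A : WFA α n} {d : Fin n → ℝ} (h : A.IsSVA d)
    (hpre : Summable fun x => √(∑ i, A.pre x i ^ 2)) (m : ℕ) :
    Summable (fun x =>
      (A.fn x - (A.transform (truncMatrix m n) (truncMatrix m n)ᵀ).fn x) ^ 2) ∧
    ∑' x, (A.fn x - (A.transform (truncMatrix m n) (truncMatrix m n)ᵀ).fn x) ^ 2 ≤
      (∑' x, √(∑ i, A.pre x i ^ 2)) ^ 2 * ∑ i with m ≤ (i : Fin n).val, d i := by
  have hb0 : ∀ x, 0 ≤ ∑ i with m ≤ (i : Fin n).val, A.truncSuf m x i ^ 2 :=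
    fun x => sum_nonneg fun _ _ => sq_nonneg _
  have hsq : ∀ x, √(∑ i with m ≤ (i : Fin n).val, A.truncSuf m x i ^ 2) ^ 2 =
      ∑ i with m ≤ (i : Fin n).val, A.truncSuf m x i ^ 2 := fun x => Real.sq_sqrt (hb0 x)
  have hF : ∀ F : Finset (List α),
      ∑ x ∈ F, √(∑ i with m ≤ (i : Fin n).val, A.truncSuf m x i ^ 2) ^ 2 ≤
        ∑ i with m ≤ (i : Fin n).val, d i := by
    intro F
    simp only [hsq]
    rw [sum_comm]
    exact sum_le_sum fun i _ => h.sum_truncSuf_le m i F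
  have hsb := summable_of_sum_le (fun x => sq_nonneg _) hF
  have hle := hsb.tsum_le_of_sum_le hF
  obtain ⟨h1, h2⟩ := tsum_sq_le_of_convolution
    (a := fun x => √(∑ i, A.pre x i ^ 2))
    (b := fun x => √(∑ i with m ≤ (i : Fin n).val, A.truncSuf m x i ^ 2))
    (e := fun x => A.fn x - (A.transform (truncMatrix m n) (truncMatrix m n)ᵀ).fn x)
    (fun _ => Real.sqrt_nonneg _) hpre hsb (fun x => by
      rw [fn_sub_fn_truncate]
      refine (abs_sum_le_sum_abs _ _).trans (sum_le_sum fun k _ => ?_)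
      rw [← Real.sqrt_mul (sum_nonneg fun _ _ => sq_nonneg _)]
      refine Real.abs_le_sqrt ((sum_mul_sq_le_sq_mul_sq _ _ _).trans ?_)
      -- The forward norm is enlarged to all coordinates: this full norm is the quantity determined
      -- by `f`.
      exact mul_le_mul_of_nonneg_right
        (sum_le_sum_of_subset_of_nonneg (filter_subset _ _) fun _ _ _ => sq_nonneg _) (hb0 _))
  exact ⟨h1, h2.trans (mul_le_mul_of_nonneg_left hle (sq_nonneg _))⟩

/-- The Euclidean norms of the forward vectors of a singular value automaton depend only on the
realized function. -/
theorem IsSVA.sum_pre_sq_unique {A B : WFA α n} {d e : Fin n → ℝ} (hA : A.IsSVA d)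
    (hB : B.IsSVA e) (hAB : A.fn = B.fn) (x : List α) :
    ∑ i, A.pre x i ^ 2 = ∑ i, B.pre x i ^ 2 := by
  -- The left singular vectors are `pre / √c`, so weighting their squares by `c` recovers `‖pre
  -- x‖²`.
  have key : ∀ {C : WFA α n} {c : Fin n → ℝ}, C.IsSVA c →
      ∑ i, c i * (C.pre x i / √(c i)) ^ 2 = ∑ i, C.pre x i ^ 2 := by
    intro C c hC
    refine sum_congr rfl fun i _ => ?_
    rw [div_pow, Real.sq_sqrt (hC.pos i).le, mul_div_cancel₀ _ (hC.pos i).ne']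
  have hA' := hA.isReducedSVD_hankel
  rw [hAB] at hA'
  rw [← key hA, ← key hB]
  exact hA'.sum_mul_sq_unique hB.isReducedSVD_hankel x

theorem IsMinimal.summable_norm_pre {A : WFA α n} (hA : A.IsMinimal)
    (hf : Summable fun x => |A.fn x|) : Summable fun x => √(∑ i, A.pre x i ^ 2) := by
  refine Summable.of_nonneg_of_le (fun _ => Real.sqrt_nonneg _) (fun x => ?_)
    (summable_sum fun i (_ : i ∈ univ) => hA.summable_pre hf i)
  rw [Real.sqrt_le_left (sum_nonneg fun _ _ => abs_nonneg _)]
  simp only [← sq_abs (A.pre x _)]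
  exact sum_sq_le_sq_sum_of_nonneg fun _ _ => abs_nonneg _

end WFA

/-! ### The main theorem -/

theorem IsRational.exists_wfa {α : Type*} {f : List α → ℝ} (hrat : IsRational f) {n : ℕ}
    (hn : seriesRank f = n) : ∃ A : WFA α n, A.fn = f := by
  have : seriesRank f ∈ {m : ℕ | ∃ A : WFA α m, A.fn = f} := Nat.sInf_mem hrat
  rwa [hn] at this

end

theorem mainTheorem1 {α : Type*} [Fintype α] (f : List α → ℝ) (hrat : IsRational f)
    (hf : Summable fun x => |f x|) (n : ℕ) (hn : seriesRank f = n) :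
    (∃ s : Fin n → ℝ, IsHankelSingularValues f s) ∧
    ∃ C : ℝ, 0 < C ∧
      ∀ s : Fin n → ℝ, IsHankelSingularValues f s →
      ∀ m : ℕ, 0 < m → m < n →
      ∀ A : WFA α n, A.IsMinimal → A.fn = f → matrixSpectralRadius A.tensorSq < 1 →
        (∃ B : WFA α m, SVATruncation A m B) ∧
        ∀ B : WFA α m, SVATruncation A m B →
          Summable (fun x => (f x - B.fn x) ^ 2) ∧
          ∑' x, (f x - B.fn x) ^ 2 ≤
            C * √(∑ i ∈ Finset.univ.filter (fun i : Fin n => m ≤ (i : ℕ)), s i) := by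
  obtain ⟨A₁, hA₁⟩ := hrat.exists_wfa hn
  have hmin : ∀ A : WFA α n, A.fn = f → A.IsMinimal := fun A hA => by
    rw [WFA.IsMinimal, hA, hn]
  obtain ⟨A₀, d, hSVA, hA₀⟩ := (hmin A₁ hA₁).exists_isSVA (by rwa [hA₁])
  rw [hA₁] at hA₀
  have hSVD := hSVA.isReducedSVD_hankel
  rw [hA₀] at hSVD
  have hpre := (hmin A₀ hA₀).summable_norm_pre (by rwa [hA₀])
  -- The constant comes from one reference automaton `A₀`, fixed before `A` and `m`; the `+ 1`
  -- ensures positivity, even for `n = 0`.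
  refine ⟨⟨d, _, _, hSVD⟩, (∑' x, √(∑ i, A₀.pre x i ^ 2)) ^ 2 * √(∑ i, d i) + 1,
    by positivity, ?_⟩
  rintro s ⟨U, V, hs⟩ m - - A hA hAf hρ
  obtain rfl : s = d := hs.singularValues_unique hSVD
  have hfA : Summable fun x => |A.fn x| := by rwa [hAf]
  refine ⟨?_, ?_⟩
  · obtain ⟨A', hA'⟩ := hA.exists_computeSVA hfA hρ
    exact ⟨_, A', hA', rfl⟩
  rintro B ⟨A', hA', rfl⟩
  obtain ⟨d', hSVA', hfn⟩ := hA.isSVA_of_computeSVA hfA hρ hA'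
  rw [hAf] at hfn
  have hSVD' := hSVA'.isReducedSVD_hankel
  rw [hfn] at hSVD'
  obtain rfl : d' = s := hSVD'.singularValues_unique hSVD
  have hsq : ∀ x, ∑ i, A'.pre x i ^ 2 = ∑ i, A₀.pre x i ^ 2 :=
    hSVA'.sum_pre_sq_unique hSVA (hfn.trans hA₀.symm)
  obtain ⟨h1, h2⟩ := hSVA'.truncation_error (by simpa only [hsq] using hpre) m
  rw [hfn] at h1 h2
  refine ⟨h1, h2.trans ?_⟩
  simp only [hsq]
  have ht0 : 0 ≤ ∑ i ∈ Finset.univ.filter (fun i : Fin n => m ≤ (i : ℕ)), d' i :=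
    Finset.sum_nonneg fun i _ => (hSVA'.pos i).le
  have htle : ∑ i ∈ Finset.univ.filter (fun i : Fin n => m ≤ (i : ℕ)), d' i ≤ ∑ i, d' i :=
    Finset.sum_le_sum_of_subset_of_nonneg (Finset.filter_subset _ _)
      fun i _ _ => (hSVA'.pos i).le
  set t := ∑ i ∈ Finset.univ.filter (fun i : Fin n => m ≤ (i : ℕ)), d' i
  -- The bound obtained is linear in the tail `t`; one factor `√t` is absorbed into the constant
  -- through `t ≤ ∑ i, d' i`.
  calc _ = (∑' x, √(∑ i, A₀.pre x i ^ 2)) ^ 2 * √t * √t := by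
        rw [mul_assoc, Real.mul_self_sqrt ht0]
    _ ≤ (∑' x, √(∑ i, A₀.pre x i ^ 2)) ^ 2 * √(∑ i, d' i) * √t := by
        gcongr
    _ ≤ _ := by
        have := Real.sqrt_nonneg t
        linarith
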